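/- For $\theta\in\mathbb{R}$ let $\mathbb{C}_\theta=\{s\in\mathbb{C}:\operatorname{Re}s>\theta\}$. Let $\mathcal{H}^2$ be the Hilbert space of Dirichlet series $f(s)=\sum_{n\ge1}a_nn^{-s}$ with $\|f\|_{\mathcal{H}^2}^2=\sum_{n\ge1}|a_n|^2<\infty$, regarded as holomorphic functions on $\mathbb{C}_{1/2}$. Let $\mathcal{G}_0$ be the class of functions $\Phi(s)=\sum_{n\ge1}c_nn^{-s}$ whose Dirichlet series converges uniformly in $\mathbb{C}_\delta$ for every $\delta>0$ and which satisfy $\Phi(\mathbb{C}_0)\subset\mathbb{C}_{1/2}$. Let $\Phi\in\mathcal{G}_0$ and $\varepsilon>0$, and suppose that $\Phi$ (as a function on $\mathbb{C}_{1/2}$) extends to a holomorphic map $\mathbb{C}_0\to\mathbb{C}_{1/2+\varepsilon}$; equivalently, $\Phi(\mathbb{C}_0)\subset\mathbb{C}_{1/2+\varepsilon}$. Then the composition-differentiation operator $D_\Phi f=f'\circ\Phi$ is a bounded linear operator from $\mathcal{H}^2$ to $\mathcal{H}^2$; that is, for every $f\in\mathcal{H}^2$ the function $f'\circ\Phi$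 on $\mathbb{C}_{1/2}$ belongs to $\mathcal{H}^2$, and there is a constant $C$, independent of $f$, with $\|f'\circ\Phi\|_{\mathcal{H}^2}\le C\|f\|_{\mathcal{H}^2}$. -/

import Mathlib

open Set Filter Topology

namespace HardyDirichlet

/-- The open half-plane `ℂ_θ = {s : Re s > θ}`. -/
def halfPlane (θ : ℝ) : Set ℂ := {s : ℂ | θ < s.re}

/-- The Hardy-Hilbert space of Dirichlet series `f(s) = ∑_{n ≥ 1} a_n n^{-s}` with
`‖f‖² = ∑ |a_n|² < ∞`. An element is stored as its square summable coefficient sequence, with the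
`ℓ²` inner product; the holomorphic function on `ℂ_{1/2}` which it stands for is `H2.toFun`, and
`H2.ext_toFun` says that this function determines the element. -/
abbrev H2 : Type := lp (fun _ : ℕ+ => ℂ) 2

/-- The function `s ↦ ∑_{n ≥ 1} a_n n^{-s}` defined by an element of `H2`; it is only meaningful on
`ℂ_{1/2}`, where the series converges absolutely. -/
noncomputable def H2.toFun (f : H2) (s : ℂ) : ℂ :=
  ∑' n : ℕ+, f n * (n : ℂ) ^ (-s)

/-- The class of symbols of characteristic zero: `Φ(s) = ∑_{n ≥ 1} c_n n^{-s}` on `ℂ_0`, the series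
converging uniformly in `ℂ_δ` for every `δ > 0`, and `Φ(ℂ_0) ⊆ ℂ_{1/2}`. The values of `Φ` off
`ℂ_0` play no role. -/
def MemG0 (Φ : ℂ → ℂ) : Prop :=
  (∃ c : ℕ → ℂ, ∀ δ : ℝ, 0 < δ →
    TendstoUniformlyOn (fun (N : ℕ) (s : ℂ) => ∑ n ∈ Finset.Icc 1 N, c n * (n : ℂ) ^ (-s))
      Φ atTop (halfPlane δ)) ∧
  MapsTo Φ (halfPlane 0) (halfPlane (1 / 2))

/-- `Φ` extends from `ℂ_{1/2}` to a holomorphic map `ℂ_0 → ℂ_θ`. -/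
def ExtendsHolomorphically (Φ : ℂ → ℂ) (θ : ℝ) : Prop :=
  ∃ Ψ : ℂ → ℂ, DifferentiableOn ℂ Ψ (halfPlane 0) ∧ EqOn Ψ Φ (halfPlane (1 / 2)) ∧
    MapsTo Ψ (halfPlane 0) (halfPlane θ)

/-- `T` is the composition-differentiation operator `D_Φ f = f' ∘ Φ`, as functions on `ℂ_{1/2}`. -/
def IsCompDiffOp (Φ : ℂ → ℂ) (T : H2 → H2) : Prop :=
  ∀ f : H2, ∀ s ∈ halfPlane (1 / 2), H2.toFun (T f) s = deriv (H2.toFun f) (Φ s)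

theorem H2.summable (f : H2) {s : ℂ} (hs : s ∈ halfPlane (1 / 2)) :
    Summable fun n : ℕ+ => f n * (n : ℂ) ^ (-s) := by
  have hs' : (1 / 2 : ℝ) < s.re := hs
  have h1 : Summable fun n : ℕ+ => ‖f n‖ ^ 2 := by
    have := (lp.memℓp f).summable (by norm_num)
    simpa using this
  have h2 : Summable fun n : ℕ+ => ‖((n : ℕ) : ℂ) ^ (-s)‖ ^ 2 := by
    have h3 : Summable fun n : ℕ => 1 / (n : ℝ) ^ (2 * s.re) :=
      Real.summable_one_div_nat_rpow.2 (by linarith)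
    refine (h3.comp_injective PNat.coe_injective).congr fun n => ?_
    rw [Complex.norm_natCast_cpow_of_pos n.pos, Function.comp_apply, Complex.neg_re,
      Real.rpow_neg (by positivity), one_div, inv_pow, ← Real.rpow_natCast, ← Real.rpow_mul
      (by positivity), mul_comm s.re]
    norm_num
  refine Summable.of_norm_bounded (h1.add h2) fun n => ?_
  rw [norm_mul]
  nlinarith [sq_nonneg (‖f n‖ - ‖((n : ℕ) : ℂ) ^ (-s)‖), sq_nonneg ‖f n‖,
    sq_nonneg ‖((n : ℕ) : ℂ) ^ (-s)‖]

theorem H2.ext_toFun {f g : H2} (h : EqOn (H2.toFun f) (H2.toFun g) (halfPlane (1 / 2))) :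
    f = g := by
  let ex : H2 → ℕ → ℂ := fun f n => if hn : 0 < n then f ⟨n, hn⟩ else 0
  have exn : ∀ (f : H2) (s : ℂ) (n : ℕ+),
      LSeries.term (ex f) s (n : ℕ) = f n * (n : ℂ) ^ (-s) := by
    intro f s n
    rw [LSeries.term_of_ne_zero n.ne_zero, Complex.cpow_neg, div_eq_mul_inv]
    simp only [ex, n.pos, dif_pos]
    rfl
  have ex0 : ∀ (f : H2) (s : ℂ), ∀ n ∉ Set.range ((↑) : ℕ+ → ℕ), LSeries.term (ex f) s n = 0 := by
    intro f s n hn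
    rcases Nat.eq_zero_or_pos n with rfl | h0
    · simp
    · exact absurd ⟨⟨n, h0⟩, rfl⟩ hn
  have hsum : ∀ (f : H2) (s : ℂ), s ∈ halfPlane (1 / 2) → LSeriesSummable (ex f) s := by
    intro f s hs
    refine (PNat.coe_injective.summable_iff (ex0 f s)).1 ?_
    exact (H2.summable f hs).congr fun n => (exn f s n).symm
  have hval : ∀ (f : H2) (s : ℂ), LSeries (ex f) s = H2.toFun f s := by
    intro f s
    unfold LSeries H2.toFun
    rw [← PNat.coe_injective.tsum_eq (f := LSeries.term (ex f) s)]
    · exact tsum_congr fun n => exn f s n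
    · intro n hn
      by_contra h0
      exact hn (ex0 f s n h0)
  have h1 : (1 : ℂ) ∈ halfPlane (1 / 2) := by simp [halfPlane]; norm_num
  have habs : ∀ f : H2, LSeries.abscissaOfAbsConv (ex f) < ⊤ := fun f =>
    lt_of_le_of_lt (hsum f 1 h1).abscissaOfAbsConv_le (EReal.coe_lt_top _)
  have hev : (fun x : ℝ => LSeries (ex f) x) =ᶠ[atTop] fun x => LSeries (ex g) x := by
    filter_upwards [eventually_gt_atTop (1 / 2 : ℝ)] with x hx
    rw [hval, hval]
    exact h (by simpa [halfPlane] using hx)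
  ext n
  have := LSeries.eq_of_LSeries_eventually_eq (habs f) (habs g) hev n.ne_zero
  simp only [ex, n.pos, dif_pos] at this
  exact this

end HardyDirichlet

/-!
The series defining `f'` converges absolutely on `ℂ_{1/2+ε}`, with `|f'| ≤ C ‖f‖` there, so `f' ∘ Φ`
is bounded by `C ‖f‖` on all of `ℂ_0`. The theorem is therefore an instance of the contractive
inclusion into `H2` of the bounded functions on `ℂ_0` which are given by Dirichlet series: the
operator even maps `H2` into bounded functions.

To see that `f' ∘ Φ` is given by a Dirichlet series, fix `δ > 0` and translate by `δ`. By hypothesis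
`Φ (· + δ)` is a uniform limit of Dirichlet polynomials on `ℂ_0`. Such limits form a closed algebra
of bounded functions (`dirichletAlgebra`), which is therefore stable under `F ↦ n^{-F}`
(`exists_cpow_neg_mem_dirichletAlgebra`); approximating `f` in `H2` by finite sums, it contains
`f' ∘ Φ (· + δ)` (`exists_deriv_comp_mem_dirichletAlgebra`). For a Dirichlet polynomial `P` with
coefficients `b_n`, the mean value of `|P|²` on the imaginary axis is `∑ |b_n|²`, so the `H2` norm
is at most the supremum norm (`norm_coefficients_le`), and this passes to uniform limits
(`exists_H2_of_mem_dirichletAlgebra`).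

This places `f' ∘ Φ (· + δ)` in the ball of radius `C ‖f‖` of `H2` for every `δ > 0`. By uniqueness
of coefficients the translates come from one sequence `a_n`, and `∑ |a_n|² n^{-2δ} ≤ C² ‖f‖²` gives
the result as `δ → 0` (`exists_H2_of_forall_translate`). Linearity of the operator follows from the
uniqueness of the element of `H2` representing a function.
-/

open scoped BoundedContinuousFunction

namespace HardyDirichlet

/-! ### Evaluation and differentiation on `H2` -/

theorem isOpen_halfPlane (θ : ℝ) : IsOpen (halfPlane θ) :=
  isOpen_lt continuous_const Complex.continuous_re

theorem halfPlane_subset {θ₁ θ₂ : ℝ} (h : θ₁ ≤ θ₂) : halfPlane θ₂ ⊆ halfPlane θ₁ :=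
  fun _ hs => lt_of_le_of_lt h hs

theorem H2.norm_sq_eq_tsum (f : H2) : ‖f‖ ^ 2 = ∑' n, ‖f n‖ ^ 2 := by
  simpa using lp.norm_rpow_eq_tsum (p := 2) (by norm_num) f

theorem H2.summable_norm_sq (f : H2) : Summable fun n => ‖f n‖ ^ 2 := by
  simpa using (lp.memℓp f).summable (by norm_num)

theorem norm_pnat_cpow_neg (n : ℕ+) (s : ℂ) : ‖(n : ℂ) ^ (-s)‖ = (n : ℝ) ^ (-s.re) := by
  rw [Complex.norm_natCast_cpow_of_pos n.pos, Complex.neg_re]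

theorem one_le_pnat_cast (n : ℕ+) : (1 : ℝ) ≤ n := by exact_mod_cast n.2

theorem summable_norm_sq_pnat_cpow_neg {s : ℂ} (hs : s ∈ halfPlane (1 / 2)) :
    Summable fun n : ℕ+ => ‖(n : ℂ) ^ (-s)‖ ^ 2 := by
  have hs' : (1 / 2 : ℝ) < s.re := hs
  have h : Summable fun n : ℕ => (n : ℝ) ^ (-(2 * s.re)) :=
    Real.summable_nat_rpow.2 (by linarith)
  refine (h.comp_injective PNat.coe_injective).congr fun n => ?_
  rw [norm_pnat_cpow_neg, Function.comp_apply, ← Real.rpow_natCast,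
    ← Real.rpow_mul (by positivity)]
  congr 1
  push_cast
  ring

/-- The reproducing kernel of `H2` at a point `s` of `ℂ_{1/2}`: the sequence of the conjugates of
`n^{-s}`. -/
noncomputable def evalKernel (s : ℂ) (hs : s ∈ halfPlane (1 / 2)) : H2 :=
  ⟨fun n => star ((n : ℂ) ^ (-s)), by
    refine (memℓp_gen_iff (by norm_num)).2 ?_
    simpa using summable_norm_sq_pnat_cpow_neg hs⟩

theorem H2.toFun_eq_inner (f : H2) {s : ℂ} (hs : s ∈ halfPlane (1 / 2)) :
    H2.toFun f s = inner ℂ (evalKernel s hs) f := by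
  rw [lp.inner_eq_tsum]
  refine tsum_congr fun n => ?_
  simp [evalKernel]

theorem norm_evalKernel_le {s z : ℂ} (hs : s ∈ halfPlane (1 / 2)) (hz : z ∈ halfPlane (1 / 2))
    (h : s.re ≤ z.re) : ‖evalKernel z hz‖ ≤ ‖evalKernel s hs‖ := by
  refine le_of_sq_le_sq ?_ (norm_nonneg _)
  rw [H2.norm_sq_eq_tsum, H2.norm_sq_eq_tsum]
  refine (H2.summable_norm_sq _).tsum_le_tsum (fun n => ?_) (H2.summable_norm_sq _)
  simp only [evalKernel, norm_star, norm_pnat_cpow_neg]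
  gcongr
  exact one_le_pnat_cast n

theorem H2.toFun_add (f g : H2) {s : ℂ} (hs : s ∈ halfPlane (1 / 2)) :
    H2.toFun (f + g) s = H2.toFun f s + H2.toFun g s := by
  simp only [H2.toFun_eq_inner _ hs, inner_add_right]

theorem H2.toFun_smul (c : ℂ) (f : H2) {s : ℂ} (hs : s ∈ halfPlane (1 / 2)) :
    H2.toFun (c • f) s = c * H2.toFun f s := by
  simp only [H2.toFun_eq_inner _ hs, inner_smul_right]

theorem H2.toFun_single (n : ℕ+) (a : ℂ) (s : ℂ) :
    H2.toFun (lp.single 2 n a) s = a * (n : ℂ) ^ (-s) := by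
  unfold H2.toFun
  rw [tsum_eq_single n fun m hm => by simp [lp.single_apply, hm]]
  simp [lp.single_apply]

theorem mem_halfPlane_ofReal {θ σ : ℝ} (h : θ < σ) : (σ : ℂ) ∈ halfPlane θ := by
  simpa [halfPlane] using h

/-- Point evaluation on `H2` is bounded uniformly on each half-plane `ℂ_σ`, `σ > 1/2`. -/
theorem H2.exists_norm_toFun_le {σ : ℝ} (hσ : 1 / 2 < σ) :
    ∃ C : ℝ, 0 ≤ C ∧ ∀ (f : H2), ∀ s ∈ halfPlane σ, ‖H2.toFun f s‖ ≤ C * ‖f‖ := by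
  refine ⟨‖evalKernel σ (mem_halfPlane_ofReal hσ)‖, norm_nonneg _, fun f s hs => ?_⟩
  rw [H2.toFun_eq_inner f (halfPlane_subset hσ.le hs)]
  refine (norm_inner_le_norm _ _).trans ?_
  gcongr
  refine norm_evalKernel_le _ _ ?_
  have : σ < s.re := hs
  simpa using this.le

theorem hasDerivAt_pnat_cpow_neg (n : ℕ+) (s : ℂ) :
    HasDerivAt (fun z : ℂ => (n : ℂ) ^ (-z)) (-Complex.log n * (n : ℂ) ^ (-s)) s := by
  have hn : (n : ℂ) ≠ 0 := by exact_mod_cast n.ne_zero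
  convert (hasDerivAt_neg s).const_cpow (c := (n : ℂ)) (Or.inl hn) using 1
  ring

theorem H2.differentiableOn_toFun (f : H2) :
    DifferentiableOn ℂ (H2.toFun f) (halfPlane (1 / 2)) := by
  intro s hs
  obtain ⟨σ, hσ, hσs⟩ := exists_between (show 1 / 2 < s.re from hs)
  obtain ⟨C, hC, hb⟩ := H2.exists_norm_toFun_le hσ
  have hlim : Tendsto (fun S : Finset ℕ+ => ∑ n ∈ S, lp.single 2 n (f n)) atTop (𝓝 f) :=
    lp.hasSum_single (by norm_num) f
  have hu : TendstoUniformlyOn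
      (fun (S : Finset ℕ+) => H2.toFun (∑ n ∈ S, (lp.single 2 n (f n) : H2)))
      (H2.toFun f) atTop (halfPlane σ) := by
    rw [Metric.tendstoUniformlyOn_iff]
    intro η hη
    have h0 : Tendsto (fun S : Finset ℕ+ => C * ‖f - ∑ n ∈ S, (lp.single 2 n (f n) : H2)‖)
        atTop (𝓝 0) := by
      simpa using ((tendsto_const_nhds (x := f)).sub hlim).norm.const_mul C
    filter_upwards [h0.eventually (gt_mem_nhds hη)] with S hS z hz
    have hz' := halfPlane_subset hσ.le hz
    rw [dist_eq_norm, H2.toFun_eq_inner _ hz', H2.toFun_eq_inner _ hz', ← inner_sub_right,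
      ← H2.toFun_eq_inner _ hz']
    exact (hb _ z hz).trans_lt hS
  refine ((hu.tendstoLocallyUniformlyOn.differentiableOn (.of_forall fun S => ?_)
    (isOpen_halfPlane σ)).differentiableAt ((isOpen_halfPlane σ).mem_nhds hσs)
    ).differentiableWithinAt
  have hS : EqOn (H2.toFun (∑ n ∈ S, (lp.single 2 n (f n) : H2)))
      (fun z => ∑ n ∈ S, f n * (n : ℂ) ^ (-z)) (halfPlane σ) := by
    intro z hz
    have hz' := halfPlane_subset hσ.le hz
    simp only [H2.toFun_eq_inner _ hz', inner_sum]
    simp only [← H2.toFun_eq_inner _ hz', H2.toFun_single]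
  refine DifferentiableOn.congr (fun z _ => ?_) hS
  refine (DifferentiableAt.fun_sum fun n _ => ?_).differentiableWithinAt
  exact (hasDerivAt_pnat_cpow_neg n z).differentiableAt.const_mul _

theorem H2.differentiableAt_toFun (f : H2) {s : ℂ} (hs : s ∈ halfPlane (1 / 2)) :
    DifferentiableAt ℂ (H2.toFun f) s :=
  (H2.differentiableOn_toFun f).differentiableAt ((isOpen_halfPlane _).mem_nhds hs)

theorem H2.deriv_toFun_add (f g : H2) {s : ℂ} (hs : s ∈ halfPlane (1 / 2)) :
    deriv (H2.toFun (f + g)) s = deriv (H2.toFun f) s + deriv (H2.toFun g) s := by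
  rw [← deriv_add (f.differentiableAt_toFun hs) (g.differentiableAt_toFun hs)]
  refine EventuallyEq.deriv_eq ?_
  filter_upwards [(isOpen_halfPlane _).mem_nhds hs] with z hz using H2.toFun_add f g hz

theorem H2.deriv_toFun_smul (c : ℂ) (f : H2) {s : ℂ} (hs : s ∈ halfPlane (1 / 2)) :
    deriv (H2.toFun (c • f)) s = c * deriv (H2.toFun f) s := by
  rw [← deriv_const_mul c (f.differentiableAt_toFun hs)]
  refine EventuallyEq.deriv_eq ?_
  filter_upwards [(isOpen_halfPlane _).mem_nhds hs] with z hz using H2.toFun_smul c f hz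

theorem H2.deriv_toFun_single (n : ℕ+) (a : ℂ) (s : ℂ) :
    deriv (H2.toFun (lp.single 2 n a)) s = -a * Complex.log n * (n : ℂ) ^ (-s) := by
  have h : H2.toFun (lp.single 2 n a) = fun z => a * (n : ℂ) ^ (-z) :=
    funext fun z => H2.toFun_single n a z
  rw [h, ((hasDerivAt_pnat_cpow_neg n s).const_mul a).deriv]
  ring

/-- Evaluation of the derivative is bounded on `H2`, uniformly on `ℂ_{1/2+ε}`: Cauchy's estimate
on discs of radius `ε/2`. -/
theorem H2.exists_norm_deriv_toFun_le {ε : ℝ} (hε : 0 < ε) :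
    ∃ C : ℝ, 0 ≤ C ∧ ∀ (f : H2), ∀ s ∈ halfPlane (1 / 2 + ε),
      ‖deriv (H2.toFun f) s‖ ≤ C * ‖f‖ := by
  obtain ⟨C, hC, hb⟩ := H2.exists_norm_toFun_le (σ := 1 / 2 + ε / 4) (by linarith)
  refine ⟨C / (ε / 2), by positivity, fun f s hs => ?_⟩
  have hball : Metric.closedBall s (ε / 2) ⊆ halfPlane (1 / 2 + ε / 4) := by
    intro z hz
    have h1 : ‖z - s‖ ≤ ε / 2 := by simpa [dist_eq_norm] using hz
    have h2 := (Complex.abs_re_le_norm (z - s)).trans h1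
    rw [Complex.sub_re, abs_le] at h2
    have h3 : 1 / 2 + ε < s.re := hs
    change 1 / 2 + ε / 4 < z.re
    linarith [h2.1]
  have hd : DifferentiableOn ℂ (H2.toFun f) (closure (Metric.ball s (ε / 2))) :=
    f.differentiableOn_toFun.mono <| Metric.closure_ball_subset_closedBall.trans <|
      hball.trans <| halfPlane_subset (by linarith)
  calc ‖deriv (H2.toFun f) s‖ ≤ C * ‖f‖ / (ε / 2) :=
        Complex.norm_deriv_le_of_forall_mem_sphere_norm_le (by positivity) hd.diffContOnCl
          fun z hz => hb f z (hball (Metric.sphere_subset_closedBall hz))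
    _ = C / (ε / 2) * ‖f‖ := by ring

/-! ### Mean values of Dirichlet polynomials -/

theorem tendsto_average_exp {c : ℝ} (hc : c ≠ 0) :
    Tendsto (fun T : ℝ => (T : ℂ)⁻¹ * ∫ t in (0 : ℝ)..T, Complex.exp (c * Complex.I * t))
      atTop (𝓝 0) := by
  have hc' : (c : ℂ) * Complex.I ≠ 0 := by simp [hc]
  refine squeeze_zero_norm (a := fun T : ℝ => |T|⁻¹ * (2 / |c|)) (fun T => ?_) ?_
  · rw [integral_exp_mul_complex hc', norm_mul, norm_inv, Complex.norm_real, Real.norm_eq_abs]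
    gcongr
    rw [norm_div]
    have h1 : ‖(c : ℂ) * Complex.I‖ = |c| := by simp
    rw [h1]
    gcongr
    refine (norm_sub_le _ _).trans (le_of_eq ?_)
    have h2 : (c : ℂ) * Complex.I * T = ((c * T : ℝ) : ℂ) * Complex.I := by push_cast; ring
    rw [h2, Complex.norm_exp_ofReal_mul_I]
    norm_num
  · simpa using (tendsto_inv_atTop_zero.comp tendsto_abs_atTop_atTop).mul_const (2 / |c|)

/-- The mean value inequality behind the contractive inclusion of bounded Dirichlet series in
`H2`. The frequencies enter only through their being pairwise distinct. -/
theorem sum_norm_sq_le_of_norm_sum_exp_le {ι : Type*} (S : Finset ι) (b : ι → ℂ) {l : ι → ℝ}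
    (hl : Function.Injective l) {M : ℝ}
    (hM : ∀ t : ℝ, ‖∑ n ∈ S, b n * Complex.exp (l n * Complex.I * t)‖ ≤ M) :
    ∑ n ∈ S, ‖b n‖ ^ 2 ≤ M ^ 2 := by
  classical
  set Q : ℝ → ℂ := fun t => ∑ n ∈ S, b n * Complex.exp (l n * Complex.I * t) with hQ
  have hexp : ∀ (n m : ι) (t : ℝ), Complex.exp (l n * Complex.I * t) *
      star (Complex.exp (l m * Complex.I * t)) =
        Complex.exp (((l n - l m : ℝ) : ℂ) * Complex.I * t) := by
    intro n m t
    rw [Complex.star_def, ← Complex.exp_conj, ← Complex.exp_add]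
    congr 1
    simp
    ring
  have hQQ : ∀ t, Q t * star (Q t) = ∑ n ∈ S, ∑ m ∈ S, b n * star (b m) *
      Complex.exp (((l n - l m : ℝ) : ℂ) * Complex.I * t) := by
    intro t
    simp only [hQ, star_sum, Finset.sum_mul_sum, ← hexp, star_mul']
    refine Finset.sum_congr rfl fun n _ => Finset.sum_congr rfl fun m _ => ?_
    ring
  have hlim : Tendsto (fun T : ℝ => (T : ℂ)⁻¹ * ∫ t in (0 : ℝ)..T, Q t * star (Q t)) atTop
      (𝓝 (∑ n ∈ S, ∑ m ∈ S, b n * star (b m) * if n = m then 1 else 0)) := by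
    have hint : ∀ T : ℝ, (T : ℂ)⁻¹ * ∫ t in (0 : ℝ)..T, Q t * star (Q t) =
        ∑ n ∈ S, ∑ m ∈ S, b n * star (b m) * ((T : ℂ)⁻¹ *
          ∫ t in (0 : ℝ)..T, Complex.exp (((l n - l m : ℝ) : ℂ) * Complex.I * t)) := by
      intro T
      simp only [hQQ]
      rw [intervalIntegral.integral_finsetSum
        fun n _ => Continuous.intervalIntegrable (by fun_prop) _ _, Finset.mul_sum]
      refine Finset.sum_congr rfl fun n _ => ?_
      rw [intervalIntegral.integral_finsetSum
        fun n _ => Continuous.intervalIntegrable (by fun_prop) _ _, Finset.mul_sum]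
      refine Finset.sum_congr rfl fun m _ => ?_
      rw [intervalIntegral.integral_const_mul]
      ring
    simp only [hint]
    refine tendsto_finsetSum _ fun n _ => tendsto_finsetSum _ fun m _ => Tendsto.const_mul _ ?_
    split_ifs with h
    · subst h
      refine tendsto_const_nhds.congr' ?_
      filter_upwards [eventually_ne_atTop (0 : ℝ)] with T hT
      have : (T : ℂ) ≠ 0 := by exact_mod_cast hT
      simp [this]
    · exact tendsto_average_exp (sub_ne_zero.2 (hl.ne h))
  have hval : (∑ n ∈ S, ∑ m ∈ S, b n * star (b m) * if n = m then 1 else 0) =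
      ((∑ n ∈ S, ‖b n‖ ^ 2 : ℝ) : ℂ) := by
    push_cast
    refine Finset.sum_congr rfl fun n hn => ?_
    simp [hn, Complex.mul_conj']
  rw [hval] at hlim
  have hle := le_of_tendsto hlim.norm (b := M ^ 2) (by
    filter_upwards [eventually_gt_atTop (0 : ℝ)] with T hT
    have h1 : ‖∫ t in (0 : ℝ)..T, Q t * star (Q t)‖ ≤ M ^ 2 * |T - 0| := by
      refine intervalIntegral.norm_integral_le_of_norm_le_const fun t _ => ?_
      rw [norm_mul, norm_star, ← sq]
      exact pow_le_pow_left₀ (norm_nonneg _) (hM t) 2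
    rw [norm_mul, norm_inv, Complex.norm_real, Real.norm_eq_abs, inv_mul_le_iff₀ (by positivity)]
    rw [sub_zero] at h1
    linarith)
  rw [Complex.norm_real, Real.norm_eq_abs] at hle
  exact (le_abs_self _).trans hle

/-! ### Uniform limits of Dirichlet polynomials -/

theorem norm_pnat_cpow_neg_le_one (n : ℕ+) {s : ℂ} (hs : s ∈ halfPlane 0) :
    ‖(n : ℂ) ^ (-s)‖ ≤ 1 := by
  have hs' : 0 < s.re := hs
  rw [norm_pnat_cpow_neg]
  exact Real.rpow_le_one_of_one_le_of_nonpos (one_le_pnat_cast n) (by linarith)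

theorem continuous_pnat_cpow_neg (n : ℕ+) : Continuous fun s : ℂ => (n : ℂ) ^ (-s) :=
  continuous_iff_continuousAt.2 fun s => (hasDerivAt_pnat_cpow_neg n s).continuousAt

/-- The bounded functions `n^{-s}` on `ℂ_0`, as a multiplicative homomorphism in `n`. -/
noncomputable def dirichletMonomial : ℕ+ →* (halfPlane 0 →ᵇ ℂ) where
  toFun n := BoundedContinuousFunction.ofNormedAddCommGroup (fun s => (n : ℂ) ^ (-(s : ℂ)))
    ((continuous_pnat_cpow_neg n).comp continuous_subtype_val) 1
    fun s => norm_pnat_cpow_neg_le_one n s.2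
  map_one' := by
    ext s
    simp
  map_mul' m n := by
    ext s
    simp [Complex.natCast_mul_natCast_cpow]

theorem dirichletMonomial_apply (n : ℕ+) (s : halfPlane 0) :
    dirichletMonomial n s = (n : ℂ) ^ (-(s : ℂ)) := rfl

/-- Dirichlet polynomials as bounded functions on `ℂ_0`. Their product is Dirichlet convolution of
the coefficients, so they are encoded by the monoid algebra of the multiplicative monoid `ℕ+`. -/
noncomputable def dirichletPolynomial : MonoidAlgebra ℂ ℕ+ →ₐ[ℂ] (halfPlane 0 →ᵇ ℂ) :=
  MonoidAlgebra.lift ℂ _ ℕ+ dirichletMonomial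

/-- The Banach algebra of uniform limits on `ℂ_0` of Dirichlet polynomials. -/
noncomputable def dirichletAlgebra : Subalgebra ℂ (halfPlane 0 →ᵇ ℂ) :=
  dirichletPolynomial.range.topologicalClosure

theorem isClosed_dirichletAlgebra : IsClosed (dirichletAlgebra : Set (halfPlane 0 →ᵇ ℂ)) :=
  Subalgebra.isClosed_topologicalClosure _

theorem dirichletMonomial_mem (n : ℕ+) : dirichletMonomial n ∈ dirichletAlgebra :=
  Subalgebra.le_topologicalClosure _
    ⟨MonoidAlgebra.single n 1, by simp [dirichletPolynomial, MonoidAlgebra.lift_single]⟩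

theorem dirichletPolynomial_apply (p : MonoidAlgebra ℂ ℕ+) (s : halfPlane 0) :
    dirichletPolynomial p s = ∑ n ∈ p.coeff.support, p.coeff n * (n : ℂ) ^ (-(s : ℂ)) := by
  simp [dirichletPolynomial, MonoidAlgebra.lift_apply, Finsupp.sum, dirichletMonomial_apply]

/-- The coefficient sequence of a Dirichlet polynomial. -/
noncomputable def coefficients : MonoidAlgebra ℂ ℕ+ →ₗ[ℂ] H2 where
  toFun p := ⟨fun n => p.coeff n, by
    refine (memℓp_gen_iff (by norm_num)).2 (summable_of_hasFiniteSupport ?_)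
    refine p.coeff.hasFiniteSupport.subset fun n hn h => hn ?_
    simp [h]⟩
  map_add' p q := rfl
  map_smul' c p := rfl

theorem coefficients_apply (p : MonoidAlgebra ℂ ℕ+) (n : ℕ+) :
    coefficients p n = p.coeff n := rfl

theorem toFun_coefficients (p : MonoidAlgebra ℂ ℕ+) (s : halfPlane 0) :
    H2.toFun (coefficients p) s = dirichletPolynomial p s := by
  rw [dirichletPolynomial_apply]
  refine tsum_eq_sum fun n hn => ?_
  rw [coefficients_apply, Finsupp.notMem_support_iff.1 hn, zero_mul]

/-- For Dirichlet polynomials the `H2` norm is at most the supremum norm on `ℂ_0`, by the mean value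
inequality on the imaginary axis. -/
theorem norm_coefficients_le (p : MonoidAlgebra ℂ ℕ+) :
    ‖coefficients p‖ ≤ ‖dirichletPolynomial p‖ := by
  have hinj : Function.Injective fun n : ℕ+ => -Real.log n := by
    intro m n h
    have := Real.log_injOn_pos (by simp : (m : ℝ) ∈ Ioi 0) (by simp : (n : ℝ) ∈ Ioi 0)
      (neg_injective h)
    exact_mod_cast this
  have hbound : ∀ t : ℝ, ‖∑ n ∈ p.coeff.support,
      p.coeff n * Complex.exp ((-Real.log n : ℝ) * Complex.I * t)‖ ≤ ‖dirichletPolynomial p‖ := by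
    intro t
    have hcont : Continuous fun s : ℂ => ∑ n ∈ p.coeff.support, p.coeff n * (n : ℂ) ^ (-s) :=
      continuous_finsetSum _ fun n _ => continuous_const.mul (continuous_pnat_cpow_neg n)
    have hlim : Tendsto (fun σ : ℝ => ∑ n ∈ p.coeff.support,
        p.coeff n * (n : ℂ) ^ (-(σ + t * Complex.I))) (𝓝[>] 0)
        (𝓝 (∑ n ∈ p.coeff.support, p.coeff n * (n : ℂ) ^ (-(((0 : ℝ) : ℂ) + t * Complex.I)))) := by
      refine Tendsto.mono_left (Continuous.tendsto ?_ 0) nhdsWithin_le_nhds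
      exact hcont.comp (Complex.continuous_ofReal.add continuous_const)
    have hval : ∑ n ∈ p.coeff.support,
        p.coeff n * Complex.exp ((-Real.log n : ℝ) * Complex.I * t) =
        ∑ n ∈ p.coeff.support, p.coeff n * (n : ℂ) ^ (-(((0 : ℝ) : ℂ) + t * Complex.I)) := by
      refine Finset.sum_congr rfl fun n _ => ?_
      have hn : (n : ℂ) ≠ 0 := by exact_mod_cast n.ne_zero
      rw [Complex.cpow_def_of_ne_zero hn]
      congr 2
      push_cast
      ring
    rw [hval]
    refine le_of_tendsto hlim.norm ?_
    filter_upwards [self_mem_nhdsWithin] with σ hσ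
    have hσ' : (σ + t * Complex.I : ℂ) ∈ halfPlane 0 := by
      simpa [halfPlane] using hσ
    have := (dirichletPolynomial p).norm_coe_le_norm ⟨_, hσ'⟩
    rwa [dirichletPolynomial_apply] at this
  refine le_of_sq_le_sq ?_ (norm_nonneg _)
  rw [H2.norm_sq_eq_tsum, tsum_eq_sum (s := p.coeff.support)]
  · exact sum_norm_sq_le_of_norm_sum_exp_le p.coeff.support p.coeff hinj hbound
  · intro n hn
    rw [coefficients_apply, Finsupp.notMem_support_iff.1 hn]
    simp

/-- The algebra of uniform limits of Dirichlet polynomials embeds contractively into `H2`. -/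
theorem exists_H2_of_mem_dirichletAlgebra {F : halfPlane 0 →ᵇ ℂ} (hF : F ∈ dirichletAlgebra) :
    ∃ v : H2, ‖v‖ ≤ ‖F‖ ∧
      ∀ s : halfPlane 0, (s : ℂ) ∈ halfPlane (1 / 2) → H2.toFun v s = F s := by
  obtain ⟨u, hu, hlim⟩ := mem_closure_iff_seq_limit.1 (show F ∈ closure _ from hF)
  choose p hp using hu
  have hp' : ∀ k, dirichletPolynomial (p k) = u k := hp
  obtain rfl : (fun k => dirichletPolynomial (p k)) = u := funext hp'
  have hcauchy : CauchySeq fun k => coefficients (p k) := by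
    rw [Metric.cauchySeq_iff]
    intro η hη
    obtain ⟨N, hN⟩ := Metric.cauchySeq_iff.1 hlim.cauchySeq η hη
    refine ⟨N, fun k hk l hl => lt_of_le_of_lt ?_ (hN k hk l hl)⟩
    rw [dist_eq_norm, dist_eq_norm, ← map_sub, ← map_sub]
    exact norm_coefficients_le _
  obtain ⟨v, hv⟩ := cauchySeq_tendsto_of_complete hcauchy
  refine ⟨v, le_of_tendsto_of_tendsto' hv.norm hlim.norm fun k => norm_coefficients_le _, ?_⟩
  intro s hs
  have h1 : Tendsto (fun k => H2.toFun (coefficients (p k)) s) atTop (𝓝 (H2.toFun v s)) := by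
    simp only [H2.toFun_eq_inner _ hs]
    exact tendsto_const_nhds.inner hv
  have h2 : Tendsto (fun k => dirichletPolynomial (p k) s) atTop (𝓝 (F s)) :=
    ((BoundedContinuousFunction.evalCLM ℂ s).continuous.tendsto F).comp hlim
  simp only [toFun_coefficients] at h1
  exact tendsto_nhds_unique h1 h2

/-! ### Composition with a symbol -/

/-- Horizontal translates of a symbol belong to the algebra of uniform limits of Dirichlet
polynomials. -/
theorem MemG0.exists_mem_dirichletAlgebra {Φ : ℂ → ℂ} (hΦ : MemG0 Φ) {δ : ℝ} (hδ : 0 < δ) :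
    ∃ F ∈ dirichletAlgebra, ∀ s : halfPlane 0, F s = Φ (s + δ) := by
  obtain ⟨⟨c, hc⟩, -⟩ := hΦ
  have hshift : ∀ s : halfPlane 0, (s + δ : ℂ) ∈ halfPlane δ := by
    intro s
    have hs : 0 < (s : ℂ).re := s.2
    change δ < (s + δ : ℂ).re
    simpa using hs
  let u : ℕ → (halfPlane 0 →ᵇ ℂ) := fun N =>
    ∑ n ∈ Finset.Icc 1 N, (c n * (n : ℂ) ^ (-(δ : ℂ))) • dirichletMonomial n.toPNat'
  have hu_mem : ∀ N, u N ∈ dirichletAlgebra := fun N =>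
    sum_mem fun n _ => dirichletAlgebra.smul_mem (dirichletMonomial_mem _) _
  have hu_apply : ∀ N (s : halfPlane 0),
      u N s = ∑ n ∈ Finset.Icc 1 N, c n * (n : ℂ) ^ (-(s + δ : ℂ)) := by
    intro N s
    simp only [u, BoundedContinuousFunction.coe_sum, Finset.sum_apply,
      BoundedContinuousFunction.coe_smul, dirichletMonomial_apply, smul_eq_mul]
    refine Finset.sum_congr rfl fun n hn => ?_
    have hn1 : 0 < n := (Finset.mem_Icc.1 hn).1
    have hn0 : (n : ℂ) ≠ 0 := by exact_mod_cast hn1.ne'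
    have hcast : ((n.toPNat' : ℕ) : ℂ) = n := by
      rw [Nat.toPNat'_coe, if_pos hn1]
    rw [hcast, neg_add_rev, Complex.cpow_add _ _ hn0, mul_assoc]
  have hcauchy : CauchySeq u := by
    rw [Metric.cauchySeq_iff]
    intro η hη
    obtain ⟨N, hN⟩ := Metric.uniformCauchySeqOn_iff.1 (hc δ hδ).uniformCauchySeqOn (η / 2)
      (by positivity)
    refine ⟨N, fun k hk l hl => lt_of_le_of_lt ?_ (half_lt_self hη)⟩
    refine (BoundedContinuousFunction.dist_le (by positivity)).2 fun s => ?_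
    rw [hu_apply, hu_apply]
    exact (hN k hk l hl _ (hshift s)).le
  obtain ⟨F, hF⟩ := cauchySeq_tendsto_of_complete hcauchy
  refine ⟨F, isClosed_dirichletAlgebra.mem_of_tendsto hF (.of_forall hu_mem), fun s => ?_⟩
  have h1 : Tendsto (fun N => u N s) atTop (𝓝 (F s)) :=
    ((BoundedContinuousFunction.evalCLM ℂ s).continuous.tendsto F).comp hF
  have h2 := (hc δ hδ).tendsto_at (hshift s)
  simp only [hu_apply] at h1
  exact tendsto_nhds_unique h1 h2

/-- The algebra of uniform limits of Dirichlet polynomials is stable under `F ↦ n^{-F}`, since it is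
a closed algebra and hence contains exponentials of its elements. -/
theorem exists_cpow_neg_mem_dirichletAlgebra (n : ℕ+) {F : halfPlane 0 →ᵇ ℂ}
    (hF : F ∈ dirichletAlgebra) :
    ∃ G ∈ dirichletAlgebra, ∀ s, G s = (n : ℂ) ^ (-F s) := by
  refine ⟨NormedSpace.exp ((-Complex.log n) • F), ?_, fun s => ?_⟩
  · exact NormedSpace.exp_mem isClosed_dirichletAlgebra (dirichletAlgebra.smul_mem hF _)
  · have hsum := NormedSpace.exp_series_hasSum_exp' (𝕂 := ℂ) ((-Complex.log n) • F)
    have h1 := hsum.map (BoundedContinuousFunction.evalCLM ℂ s)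
      (BoundedContinuousFunction.evalCLM ℂ s).continuous
    have h2 := NormedSpace.exp_series_hasSum_exp' (𝕂 := ℂ) (-Complex.log n * F s)
    have hn : (n : ℂ) ≠ 0 := by exact_mod_cast n.ne_zero
    rw [Complex.cpow_def_of_ne_zero hn, show Complex.log n * -F s = -Complex.log n * F s by ring,
      Complex.exp_eq_exp_ℂ]
    refine h1.unique (h2.congr_fun fun k => ?_)
    simp

/-- If a uniform limit `F` of Dirichlet polynomials takes values in `ℂ_{1/2+ε}`, then every
`f' ∘ F` with `f` in `H2` is again such a limit. This is clear for `f = a n^{-s}`, and the bound on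
derivatives on `ℂ_{1/2+ε}` makes the property pass to limits in `H2`. -/
theorem exists_deriv_comp_mem_dirichletAlgebra {ε : ℝ} (hε : 0 < ε) {C : ℝ}
    (hC : ∀ (f : H2), ∀ s ∈ halfPlane (1 / 2 + ε), ‖deriv (H2.toFun f) s‖ ≤ C * ‖f‖)
    {F : halfPlane 0 →ᵇ ℂ} (hF : F ∈ dirichletAlgebra)
    (hmaps : ∀ s, F s ∈ halfPlane (1 / 2 + ε)) (f : H2) :
    ∃ G ∈ dirichletAlgebra, ∀ s, G s = deriv (H2.toFun f) (F s) := by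
  have hsub : halfPlane (1 / 2 + ε) ⊆ halfPlane (1 / 2) := halfPlane_subset (by linarith)
  let L₀ : H2 →ₗ[ℂ] (halfPlane 0 →ᵇ ℂ) :=
    { toFun := fun f => BoundedContinuousFunction.ofNormedAddCommGroup
        (fun s => deriv (H2.toFun f) (F s))
        (((f.differentiableOn_toFun.deriv (isOpen_halfPlane _)).continuousOn).comp_continuous
          F.continuous fun s => hsub (hmaps s)) (C * ‖f‖) fun s => hC f _ (hmaps s)
      map_add' := fun f g => by
        ext s
        exact H2.deriv_toFun_add f g (hsub (hmaps s))
      map_smul' := fun c f => by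
        ext s
        exact H2.deriv_toFun_smul c f (hsub (hmaps s)) }
  have hL₀ : ∀ f s, L₀ f s = deriv (H2.toFun f) (F s) := fun _ _ => rfl
  let L : H2 →L[ℂ] (halfPlane 0 →ᵇ ℂ) := L₀.mkContinuous C fun f =>
    (BoundedContinuousFunction.norm_le
      ((norm_nonneg _).trans (hC f _ (hmaps ⟨1, by simp [halfPlane]⟩)))).2
      fun s => hC f _ (hmaps s)
  have hsingle : ∀ (n : ℕ+) (a : ℂ), L (lp.single 2 n a) ∈ dirichletAlgebra := by
    intro n a
    obtain ⟨G, hG, hGs⟩ := exists_cpow_neg_mem_dirichletAlgebra n hF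
    have : L (lp.single 2 n a) = (-a * Complex.log n) • G := by
      ext s
      change deriv (H2.toFun (lp.single 2 n a)) (F s) = (-a * Complex.log n) * G s
      rw [H2.deriv_toFun_single, hGs]
    rw [this]
    exact dirichletAlgebra.smul_mem hG _
  refine ⟨L f, ?_, hL₀ f⟩
  have hsum := (lp.hasSum_single (by norm_num) f).map L L.continuous
  exact isClosed_dirichletAlgebra.mem_of_tendsto hsum
    (.of_forall fun S => sum_mem fun n _ => hsingle n _)

/-! ### Horizontal translates -/

/-- The element of `H2` whose function is `s ↦ f (s + δ)`. -/
noncomputable def H2.translate (f : H2) {δ : ℝ} (hδ : 0 ≤ δ) : H2 :=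
  ⟨fun n => f n * (n : ℂ) ^ (-(δ : ℂ)), (lp.memℓp f).mono' fun n => by
    rw [norm_mul, norm_pnat_cpow_neg]
    refine mul_le_of_le_one_right (norm_nonneg _) ?_
    exact Real.rpow_le_one_of_one_le_of_nonpos (one_le_pnat_cast n) (by simpa using hδ)⟩

theorem H2.translate_apply (f : H2) {δ : ℝ} (hδ : 0 ≤ δ) (n : ℕ+) :
    f.translate hδ n = f n * (n : ℂ) ^ (-(δ : ℂ)) := rfl

theorem H2.toFun_translate (f : H2) {δ : ℝ} (hδ : 0 ≤ δ) (s : ℂ) :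
    H2.toFun (f.translate hδ) s = H2.toFun f (s + δ) := by
  refine tsum_congr fun n => ?_
  have hn : (n : ℂ) ≠ 0 := by exact_mod_cast n.ne_zero
  rw [H2.translate_apply, neg_add_rev, Complex.cpow_add _ _ hn, mul_assoc]

/-- A function all of whose translates `g (· + δ)`, `δ > 0`, lie in a fixed ball of `H2` lies
itself in that ball. -/
theorem exists_H2_of_forall_translate {g : ℂ → ℂ} {M : ℝ} (hM : 0 ≤ M)
    (h : ∀ δ : ℝ, 0 < δ → ∃ v : H2, ‖v‖ ≤ M ∧
      ∀ s ∈ halfPlane (1 / 2), H2.toFun v s = g (s + δ)) :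
    ∃ v : H2, ‖v‖ ≤ M ∧ ∀ s ∈ halfPlane (1 / 2), H2.toFun v s = g s := by
  choose! v hvM hv using h
  -- The coefficients of `g` have to be those of `g (· + 1)` multiplied by `n`.
  set a : ℕ+ → ℂ := fun n => v 1 n * n with ha
  have hcoeff : ∀ δ : ℝ, 0 < δ → δ ≤ 1 → ∀ n : ℕ+, v δ n = a n * (n : ℂ) ^ (-(δ : ℂ)) := by
    intro δ hδ hδ1 n
    have hδ1' : 0 ≤ 1 - δ := by linarith
    have heq : (v δ).translate hδ1' = v 1 := by
      refine H2.ext_toFun fun s hs => ?_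
      have hs' : s + ((1 - δ : ℝ) : ℂ) ∈ halfPlane (1 / 2) := by
        have h1 : 1 / 2 < s.re := hs
        change 1 / 2 < (s + ((1 - δ : ℝ) : ℂ)).re
        rw [Complex.add_re, Complex.ofReal_re]
        linarith
      rw [H2.toFun_translate, hv δ hδ _ hs', hv 1 one_pos s hs]
      congr 1
      push_cast
      ring
    have hn : (n : ℂ) ≠ 0 := by exact_mod_cast n.ne_zero
    have hpow : (n : ℂ) ^ (-((1 - δ : ℝ) : ℂ)) * n * (n : ℂ) ^ (-(δ : ℂ)) = 1 := by
      nth_rewrite 2 [← Complex.cpow_one (n : ℂ)]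
      rw [← Complex.cpow_add _ _ hn, ← Complex.cpow_add _ _ hn]
      have : -((1 - δ : ℝ) : ℂ) + 1 + -(δ : ℂ) = 0 := by push_cast; ring
      rw [this, Complex.cpow_zero]
    simp only [ha]
    rw [← heq, H2.translate_apply, mul_assoc, mul_assoc, ← mul_assoc _ (n : ℂ), hpow, mul_one]
  have hsum : ∀ S : Finset ℕ+, ∑ n ∈ S, ‖a n‖ ^ 2 ≤ M ^ 2 := by
    intro S
    have hlim : Tendsto (fun δ : ℝ => ∑ n ∈ S, ‖a n * (n : ℂ) ^ (-(δ : ℂ))‖ ^ 2) (𝓝[>] 0)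
        (𝓝 (∑ n ∈ S, ‖a n * (n : ℂ) ^ (-((0 : ℝ) : ℂ))‖ ^ 2)) := by
      refine Tendsto.mono_left (Continuous.tendsto ?_ 0) nhdsWithin_le_nhds
      exact continuous_finsetSum _ fun n _ => (continuous_const.mul
        ((continuous_pnat_cpow_neg n).comp Complex.continuous_ofReal)).norm.pow 2
    have hzero : ∑ n ∈ S, ‖a n * (n : ℂ) ^ (-((0 : ℝ) : ℂ))‖ ^ 2 = ∑ n ∈ S, ‖a n‖ ^ 2 := by
      simp
    rw [hzero] at hlim
    refine le_of_tendsto hlim ?_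
    filter_upwards [Ioc_mem_nhdsGT (zero_lt_one' ℝ)] with δ hδ
    calc ∑ n ∈ S, ‖a n * (n : ℂ) ^ (-(δ : ℂ))‖ ^ 2 = ∑ n ∈ S, ‖v δ n‖ ^ 2 :=
          Finset.sum_congr rfl fun n _ => by rw [hcoeff δ hδ.1 hδ.2]
      _ ≤ ‖v δ‖ ^ 2 := by
          rw [H2.norm_sq_eq_tsum]
          exact (H2.summable_norm_sq _).sum_le_tsum _ fun n _ => by positivity
      _ ≤ M ^ 2 := pow_le_pow_left₀ (norm_nonneg _) (hvM δ hδ.1) 2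
  let w : H2 := ⟨a, memℓp_gen' (C := M ^ 2) (by simpa using hsum)⟩
  refine ⟨w, lp.norm_le_of_forall_sum_le (by norm_num) hM (by simpa [w] using hsum), ?_⟩
  intro s hs
  have hs' : 1 / 2 < s.re := hs
  obtain ⟨δ, hδ0, hδ⟩ := exists_between (show 0 < min 1 (s.re - 1 / 2) by
    simpa using hs')
  have hδ1 : δ ≤ 1 := (hδ.trans_le (min_le_left _ _)).le
  have hδs : δ < s.re - 1 / 2 := hδ.trans_le (min_le_right _ _)
  have heq : w.translate hδ0.le = v δ := by
    ext n
    rw [H2.translate_apply, hcoeff δ hδ0 hδ1]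
  have hmem : s - δ ∈ halfPlane (1 / 2) := by
    change 1 / 2 < (s - δ : ℂ).re
    rw [Complex.sub_re, Complex.ofReal_re]
    linarith
  have := hv δ hδ0 (s - δ) hmem
  rwa [← heq, H2.toFun_translate, sub_add_cancel] at this

/-! ### The composition-differentiation operator -/

/-- A symbol is holomorphic on `ℂ_0`, so by the identity theorem an extension of its restriction to
`ℂ_{1/2}` is the symbol itself. -/
theorem MemG0.mapsTo_of_extends {Φ : ℂ → ℂ} (hΦ : MemG0 Φ) {θ : ℝ}
    (hext : ExtendsHolomorphically Φ θ) : MapsTo Φ (halfPlane 0) (halfPlane θ) := by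
  obtain ⟨Ψ, hΨd, hΨΦ, hΨ⟩ := hext
  obtain ⟨⟨c, hc⟩, -⟩ := hΦ
  have hΦd : DifferentiableOn ℂ Φ (halfPlane 0) := by
    intro s hs
    obtain ⟨δ, hδ, hδs⟩ := exists_between (show 0 < s.re from hs)
    refine (((hc δ hδ).tendstoLocallyUniformlyOn.differentiableOn (.of_forall fun N => ?_)
      (isOpen_halfPlane δ)).differentiableAt ((isOpen_halfPlane δ).mem_nhds hδs)
      ).differentiableWithinAt
    intro z _
    refine (DifferentiableAt.fun_sum fun n hn => ?_).differentiableWithinAt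
    exact (hasDerivAt_pnat_cpow_neg ⟨n, (Finset.mem_Icc.1 hn).1⟩ z).differentiableAt.const_mul _
  have h1 : (1 : ℂ) ∈ halfPlane (1 / 2) := by
    change (1 / 2 : ℝ) < (1 : ℂ).re
    norm_num
  have heq : EqOn Ψ Φ (halfPlane 0) :=
    (hΨd.analyticOnNhd (isOpen_halfPlane 0)).eqOn_of_preconnected_of_eventuallyEq
      (hΦd.analyticOnNhd (isOpen_halfPlane 0)) (convex_halfSpace_re_gt 0).isPreconnected
      (halfPlane_subset (by norm_num) h1)
      (hΨΦ.eventuallyEq_of_mem ((isOpen_halfPlane _).mem_nhds h1))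
  intro s hs
  rw [← heq hs]
  exact hΨ hs

end HardyDirichlet

open HardyDirichlet in
theorem mainTheorem3 (Φ : ℂ → ℂ) (hΦ : HardyDirichlet.MemG0 Φ) (ε : ℝ) (hε : 0 < ε)
    (hext : HardyDirichlet.ExtendsHolomorphically Φ (1 / 2 + ε)) :
    ∃ T : HardyDirichlet.H2 →L[ℂ] HardyDirichlet.H2, HardyDirichlet.IsCompDiffOp Φ T := by
  have hmaps := hΦ.mapsTo_of_extends hext
  obtain ⟨C, hC0, hC⟩ := H2.exists_norm_deriv_toFun_le hε
  have key : ∀ f : H2, ∃ v : H2, ‖v‖ ≤ C * ‖f‖ ∧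
      ∀ s ∈ halfPlane (1 / 2), H2.toFun v s = deriv (H2.toFun f) (Φ s) := by
    intro f
    refine exists_H2_of_forall_translate (g := fun s => deriv (H2.toFun f) (Φ s))
      (by positivity) fun δ hδ => ?_
    obtain ⟨F, hF, hFs⟩ := hΦ.exists_mem_dirichletAlgebra hδ
    have hFmaps : ∀ s, F s ∈ halfPlane (1 / 2 + ε) := by
      intro s
      have hs : 0 < (s : ℂ).re := s.2
      rw [hFs]
      refine hmaps ?_
      change 0 < (s + δ : ℂ).re
      rw [Complex.add_re, Complex.ofReal_re]
      positivity
    obtain ⟨G, hG, hGs⟩ := exists_deriv_comp_mem_dirichletAlgebra hε hC hF hFmaps f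
    obtain ⟨v, hvG, hv⟩ := exists_H2_of_mem_dirichletAlgebra hG
    refine ⟨v, hvG.trans ?_, fun s hs => ?_⟩
    · refine (BoundedContinuousFunction.norm_le (by positivity)).2 fun s => ?_
      rw [hGs]
      exact hC f _ (hFmaps s)
    · rw [hv ⟨s, halfPlane_subset (by norm_num) hs⟩ hs, hGs, hFs]
  choose T hTnorm hT using key
  have hmem : ∀ s ∈ halfPlane (1 / 2), Φ s ∈ halfPlane (1 / 2) := fun s hs =>
    hΦ.2 (halfPlane_subset (by norm_num) hs)
  let T₀ : H2 →ₗ[ℂ] H2 :=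
    { toFun := T
      map_add' := fun f g => H2.ext_toFun fun s hs => by
        rw [H2.toFun_add _ _ hs, hT _ s hs, hT _ s hs, hT _ s hs,
          H2.deriv_toFun_add f g (hmem s hs)]
      map_smul' := fun c f => H2.ext_toFun fun s hs => by
        rw [RingHom.id_apply, H2.toFun_smul _ _ hs, hT _ s hs, hT _ s hs,
          H2.deriv_toFun_smul c f (hmem s hs)] }
  exact ⟨T₀.mkContinuous C hTnorm, hT⟩
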